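/- Let $\mathcal{X}\subseteq\mathbb{R}^d$ be Lebesgue measurable, equipped with its $\sigma$-algebra $\mathcal F$ of Lebesgue-measurable subsets. Let $\pi$ be a probability density on $\mathcal X$ with respect to Lebesgue measure (also denoting the corresponding distribution), let $\hat\pi\ge 0$ be a measurable function on $\mathcal X$ (an approximation to $\pi$) with $\hat\pi(x)>0$ whenever $\pi(x)>0$, and let $q(x,y)$ be a (jointly measurable) proposal density, so that $\int_{\mathcal X} q(x,y)\,dy=1$ for every $x\in\mathcal X$. Put $$r(x,y)=\frac{\pi(y)q(y,x)}{\pi(x)q(x,y)},\qquad r_1(x,y)=\frac{\hat\pi(y)q(y,x)}{\hat\pi(x)q(x,y)},\qquad r_2(x,y)=\frac{\pi(y)/\hat\pi(y)}{\pi(x)/\hat\pi(x)},$$ with values in $[0,\infty]$ (and $0/0:=0$, $\infty/\infty:=0$), and $$\alpha_{\mathrm{MH}}(x,y)=1\wedge r(x,y),\qquad \alpha_{\mathrm{DA}}(x,y)=[1\wedge r_1(x,y)]\,[1\wedge r_2(x,y)].$$ For $\alpha\in\{\alpha_{\mathrm{MH}},\alpha_{\mathrm{DA}}\}$ let $$P(x,dy)=q(x,y)\alpha(x,y)\,dy+\Bigl[1-\int_{\mathcal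 X} q(x,z)\alpha(x,z)\,dz\Bigr]\delta_x(dy);$$ this is the Metropolis--Hastings kernel $P_{\mathrm{MH}}$ when $\alpha=\alpha_{\mathrm{MH}}$ and the delayed-acceptance kernel $P_{\mathrm{DA}}$ when $\alpha=\alpha_{\mathrm{DA}}$. A Markov kernel $P$ with stationary distribution $\pi$ is called variance bounding if for every $h\in L^2(\pi)$ the asymptotic variance $\lim_{n\to\infty} n\,\mathrm{Var}\bigl[\frac1n\sum_{i=1}^n h(X_i)\bigr]$ exists and is finite, where $(X_i)_{i\ge1}$ is the Markov chain with kernel $P$ and $X_1\sim\pi$. For $m\in\mathbb R$ and $x\in\mathcal X$ let, with logarithms in $[-\infty,\infty]$, $$M_m(x)=\{y\in\mathcal X:\min(|\log r_1(x,y)|,|\log r_2(x,y)|)>m\},$$ $$C(x)=\{y\in\mathcal X:\operatorname{sign}[\log r_1(x,y)]\,\operatorname{sign}[\log r_2(x,y)]\ge 0\}.$$ Suppose that for every $\epsilon>0$ there is an $m<\infty$ such that for $\pi$-almost all $x$ there is a set $D(x)\in\mathcal F$ with $$M_m(x)\cap D(x)\subseteq C(x)\qquad\text{and}\qquad \int_{D(x)^c}q(x,y)\,dy\le\epsilon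 .$$ Then, if $P_{\mathrm{MH}}$ is variance bounding, so is $P_{\mathrm{DA}}$. -/

import Mathlib

open MeasureTheory ProbabilityTheory Filter Topology
open scoped ENNReal NNReal

namespace DelayedAcceptance

/-! ### The state space: a subset of `ℝ^d` with its Lebesgue-measurable sets -/

/-- `ℝ^d`, equipped with the `σ`-algebra of all Lebesgue-measurable sets. -/
abbrev LebesgueSpace (d : ℕ) : Type :=
  NullMeasurableSpace (EuclideanSpace ℝ (Fin d)) volume

/-- Lebesgue measure on a subset `X` of `ℝ^d`, as a measure on the type of points of `X` with the
`σ`-algebra of the traces on `X` of Lebesgue-measurable sets. -/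
noncomputable def lebesgueOn {d : ℕ} (X : Set (LebesgueSpace d)) : Measure X :=
  (Measure.completion (volume : Measure (EuclideanSpace ℝ (Fin d)))).comap Subtype.val

instance lebesgueOn.instSigmaFinite {d : ℕ} (X : Set (LebesgueSpace d)) :
    SigmaFinite (lebesgueOn X) := by
  obtain ⟨T, hTm, hTfin, hTun⟩ : ∃ T : ℕ → Set (EuclideanSpace ℝ (Fin d)),
      (∀ n, MeasurableSet (T n)) ∧ (∀ n, volume (T n) < ∞) ∧ ⋃ n, T n = Set.univ :=
    ⟨spanningSets volume, measurableSet_spanningSets _, measure_spanningSets_lt_top _,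
      iUnion_spanningSets _⟩
  set ν : Measure (LebesgueSpace d) :=
    Measure.completion (volume : Measure (EuclideanSpace ℝ (Fin d))) with hν
  by_cases h : Function.Injective (Subtype.val : X → LebesgueSpace d) ∧
      ∀ s : Set X, MeasurableSet s → NullMeasurableSet (Subtype.val '' s) ν
  · refine ⟨⟨⟨fun n => {x : X | x.1 ∈ T n}, fun _ => trivial, fun n => ?_, ?_⟩⟩⟩
    · have hm : @MeasurableSet (LebesgueSpace d) _ (T n) := (hTm n).nullMeasurableSet
      have hm' : MeasurableSet {x : X | x.1 ∈ T n} := measurable_subtype_coe hm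
      have h1 : lebesgueOn X {x : X | x.1 ∈ T n} =
          ν (Subtype.val '' {x : X | x.1 ∈ T n}) :=
        Measure.comap_apply₀ _ _ h.1 h.2 hm'.nullMeasurableSet
      have h2 : ν (Subtype.val '' {x : X | x.1 ∈ T n}) ≤ ν (T n) := by
        refine measure_mono ?_
        rintro _ ⟨x, hx, rfl⟩
        exact hx
      have h3 : ν (T n) = volume (T n) := by rw [hν, Measure.completion_apply]
      exact (h1.trans_le h2).trans_lt (h3 ▸ hTfin n)
    · ext x
      have hx : (x.1 : EuclideanSpace ℝ (Fin d)) ∈ ⋃ n, T n := by rw [hTun]; trivial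
      obtain ⟨n, hn⟩ := Set.mem_iUnion.1 hx
      exact ⟨fun _ => trivial, fun _ => Set.mem_iUnion.2 ⟨n, hn⟩⟩
  · have h0 : lebesgueOn X = 0 := dif_neg h
    rw [h0]
    infer_instance

/-! ### Stationary Markov chains and variance bounding -/

section Chains

variable {S : Type*} [MeasurableSpace S]

/-- The joint law of the first `n + 1` states `(X_0, …, X_n)` of the Markov chain with initial
distribution `π` and transition kernel `P`. -/
noncomputable def chainLaw (P : Kernel S S) (π : Measure S) :
    (n : ℕ) → Measure (Fin (n + 1) → S)
  | 0 => π.map fun x _ => x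
  | n + 1 =>
    (chainLaw P π n ⊗ₘ P.comap (fun x => x (Fin.last n)) (measurable_pi_apply _)).map
      fun z => Fin.snoc (α := fun _ => S) z.1 z.2

/-- `n * Var[(1/n) ∑ h(X_i)]`, where the sum is over the first `n` states of the chain started
from `π`; the number of states is `n + 1` here, so that it is never zero. -/
noncomputable def scaledVar (P : Kernel S S) (π : Measure S) (h : S → ℝ) (n : ℕ) : ℝ≥0∞ :=
  ((n + 1 : ℕ) : ℝ≥0∞) *
    eVar[fun x : Fin (n + 1) → S => ((n + 1 : ℕ) : ℝ)⁻¹ * ∑ i, h (x i); chainLaw P π n]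

/-- The asymptotic variance of `h` along the chain exists and equals `v`. -/
def HasAsymptoticVariance (P : Kernel S S) (π : Measure S) (h : S → ℝ) (v : ℝ≥0∞) : Prop :=
  Tendsto (scaledVar P π h) atTop (𝓝 v)

/-- `P` is variance bounding (with respect to `π`): every `h ∈ L²(π)` has a finite asymptotic
variance. -/
def VarianceBounding (P : Kernel S S) (π : Measure S) : Prop :=
  ∀ h : S → ℝ, MemLp h 2 π → ∃ v : ℝ≥0∞, v < ∞ ∧ HasAsymptoticVariance P π h v

/-! ### Propose-accept-reject kernels -/

/-- The kernel `q(x,y) α(x,y) μ(dy) + [1 - ᾱ(x)] δ_x(dy)`, where `ᾱ(x) = ∫ q(x,y) α(x,y) μ(dy)`,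
with proposal density `q` with respect to `μ` and acceptance probability `α`. -/
noncomputable def parKernel (μ : Measure S) [SFinite μ] (q : S → S → ℝ≥0)
    (α : S → S → ℝ≥0∞) : Kernel S S :=
  Kernel.withDensity (Kernel.const S μ) (fun x y => q x y * α x y) +
    Kernel.withDensity Kernel.id (fun x _ => 1 - ∫⁻ y, q x y * α x y ∂μ)

end Chains

section Ratios

variable {S : Type*}

/-- The ratio `r(x,y) = π(y) q(y,x) / (π(x) q(x,y))`, in `[0,∞]`. -/
noncomputable def rMH (π : S → ℝ≥0) (q : S → S → ℝ≥0) (x y : S) : ℝ≥0∞ :=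
  ((π y : ℝ≥0∞) * q y x) / ((π x : ℝ≥0∞) * q x y)

/-- The first-stage ratio `r₁(x,y) = π̂(y) q(y,x) / (π̂(x) q(x,y))`. -/
noncomputable def rDA₁ (πhat : S → ℝ≥0) (q : S → S → ℝ≥0) (x y : S) : ℝ≥0∞ :=
  ((πhat y : ℝ≥0∞) * q y x) / ((πhat x : ℝ≥0∞) * q x y)

/-- The second-stage ratio `r₂(x,y) = (π(y)/π̂(y)) / (π(x)/π̂(x))`. -/
noncomputable def rDA₂ (π πhat : S → ℝ≥0) (x y : S) : ℝ≥0∞ :=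
  ((π y : ℝ≥0∞) / πhat y) / ((π x : ℝ≥0∞) / πhat x)

/-- Metropolis-Hastings acceptance probability `1 ∧ r`. -/
noncomputable def alphaMH (π : S → ℝ≥0) (q : S → S → ℝ≥0) (x y : S) : ℝ≥0∞ :=
  min 1 (rMH π q x y)

/-- Delayed-acceptance acceptance probability `[1 ∧ r₁] [1 ∧ r₂]`. -/
noncomputable def alphaDA (π πhat : S → ℝ≥0) (q : S → S → ℝ≥0) (x y : S) : ℝ≥0∞ :=
  min 1 (rDA₁ πhat q x y) * min 1 (rDA₂ π πhat x y)

/-- The potential problem set `M_m(x) = {y | min(|log r₁(x,y)|, |log r₂(x,y)|) > m}`, with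
logarithms in `[-∞,∞]`. -/
def potentialProblemSet (π πhat : S → ℝ≥0) (q : S → S → ℝ≥0) (m : ℝ) (x : S) : Set S :=
  {y | (m : EReal) < ((min (ENNReal.log (rDA₁ πhat q x y)).abs
    (ENNReal.log (rDA₂ π πhat x y)).abs : ℝ≥0∞) : EReal)}

/-- The no problem set `C(x) = {y | sign(log r₁(x,y)) sign(log r₂(x,y)) ≥ 0}`. -/
def noProblemSet (π πhat : S → ℝ≥0) (q : S → S → ℝ≥0) (x : S) : Set S :=
  {y | 0 ≤ SignType.sign (ENNReal.log (rDA₁ πhat q x y)) *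
    SignType.sign (ENNReal.log (rDA₂ π πhat x y))}

end Ratios

section Kernels

variable {S : Type*} [MeasurableSpace S]

/-- The Metropolis-Hastings kernel with target density `π` and proposal density `q`. -/
noncomputable def kernelMH (μ : Measure S) [SFinite μ] (π : S → ℝ≥0) (q : S → S → ℝ≥0) :
    Kernel S S :=
  parKernel μ q (alphaMH π q)

/-- The delayed-acceptance kernel with target density `π`, approximation `π̂` and proposal
density `q`. -/
noncomputable def kernelDA (μ : Measure S) [SFinite μ] (π πhat : S → ℝ≥0) (q : S → S → ℝ≥0) :
    Kernel S S :=
  parKernel μ q (alphaDA π πhat q)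

/-- The probability distribution with density `π` with respect to `μ`. -/
noncomputable def target (μ : Measure S) (π : S → ℝ≥0) : Measure S :=
  μ.withDensity fun x => π x

end Kernels

end DelayedAcceptance

open DelayedAcceptance

/-!
A reversible kernel is variance bounding exactly when its operator on the mean-zero functions of
`L²` has a right spectral gap: the variance of the sum of the first `n` states is
`⟪f, ∑ᵢⱼ P ^ |i - j| f⟫`, which grows linearly for every `f` if `1 - P` is bounded below, and, by
the uniform boundedness principle, only then. Gaps are compared through the Dirichlet forms
`⟪f, f - P f⟫`, which integrate `|f x - f y|²` over the accepted moves. Where `y` is not a problem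
move, `r = r₁ r₂` gives `1 ∧ r ≤ e^|m| [1 ∧ r₁] [1 ∧ r₂]`; as the remaining moves are proposed with
probability at most `ε`, they contribute at most `O(ε) ‖f‖²`, which the gap of the
Metropolis-Hastings kernel absorbs for small `ε`.
-/

namespace DelayedAcceptance

section SumPowDist

/-- The sum `∑_{i,j<n} a^|i-j|`. When `a` is the transition operator of a stationary chain, its
quadratic form at a centred function is the variance of the sum over the first `n` states. -/
def sumPowDist {A : Type*} [Semiring A] (a : A) (n : ℕ) : A :=
  ∑ i ∈ Finset.range n, ∑ j ∈ Finset.range n, a ^ Nat.dist i j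

theorem sumPowDist_succ {A : Type*} [Semiring A] (a : A) (n : ℕ) :
    sumPowDist a (n + 1) = sumPowDist a n + 2 • ∑ k ∈ Finset.range n, a ^ (k + 1) + 1 := by
  have hcol : ∑ i ∈ Finset.range n, a ^ Nat.dist i n = ∑ k ∈ Finset.range n, a ^ (k + 1) := by
    rw [← Finset.sum_range_reflect]
    refine Finset.sum_congr rfl fun k hk => ?_
    have := Finset.mem_range.1 hk
    congr 1
    rw [Nat.dist_eq_sub_of_le (by lia)]
    lia
  simp only [sumPowDist, Finset.sum_range_succ, Finset.sum_add_distrib, Nat.dist_comm n, hcol,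
    Nat.dist_self, pow_zero, two_nsmul]
  abel

theorem sum_pow_succ_mul_one_sub {A : Type*} [Ring A] (a : A) (n : ℕ) :
    (∑ k ∈ Finset.range n, a ^ (k + 1)) * (1 - a) = a - a ^ (n + 1) := by
  simp only [pow_succ', ← Finset.mul_sum]
  rw [mul_assoc, geom_sum_mul_neg, mul_sub, mul_one]

theorem sumPowDist_mul_one_sub {A : Type*} [Ring A] (a : A) (n : ℕ) :
    sumPowDist a n * (1 - a) = n • (1 + a) - 2 • ∑ k ∈ Finset.range n, a ^ (k + 1) := by
  induction n with
  | zero => simp [sumPowDist]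
  | succ n ih =>
    rw [sumPowDist_succ, add_mul, add_mul, ih, smul_mul_assoc, sum_pow_succ_mul_one_sub,
      Finset.sum_range_succ, one_mul, succ_nsmul]
    module

theorem sumPowDist_eq_of_one_sub_mul_eq_one {A : Type*} [Ring A] {a b : A}
    (hb : (1 - a) * b = 1) (n : ℕ) :
    sumPowDist a n = n • ((1 + a) * b) - 2 • ((a - a ^ (n + 1)) * b * b) := by
  have hpow : ∑ k ∈ Finset.range n, a ^ (k + 1) = (a - a ^ (n + 1)) * b := by
    rw [← sum_pow_succ_mul_one_sub, mul_assoc, hb, mul_one]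
  calc sumPowDist a n = sumPowDist a n * (1 - a) * b := by rw [mul_assoc, hb, mul_one]
    _ = _ := by rw [sumPowDist_mul_one_sub, hpow, sub_mul, smul_mul_assoc, smul_mul_assoc]

theorem isSelfAdjoint_sumPowDist {A : Type*} [Semiring A] [StarRing A] {a : A}
    (ha : IsSelfAdjoint a) (n : ℕ) : IsSelfAdjoint (sumPowDist a n) :=
  isSelfAdjoint_sum _ fun _ _ => isSelfAdjoint_sum _ fun _ _ => ha.pow _

theorem tendsto_inv_smul_sumPowDist {A : Type*} [NormedRing A] [NormedAlgebra ℝ A] {a b : A}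
    (ha : ‖a‖ ≤ 1) (hb : (1 - a) * b = 1) :
    Tendsto (fun n : ℕ => (n : ℝ)⁻¹ • sumPowDist a n) atTop (𝓝 ((1 + a) * b)) := by
  have hbdd (n : ℕ) : ‖2 • ((a - a ^ (n + 1)) * b * b)‖ ≤ 2 * ((1 + 1) * ‖b‖ * ‖b‖) := by
    have hpow : ‖a ^ (n + 1)‖ ≤ 1 :=
      (norm_pow_le' a n.succ_pos).trans (pow_le_one₀ (norm_nonneg a) ha)
    have hsub : ‖a - a ^ (n + 1)‖ ≤ 1 + 1 := (norm_sub_le _ _).trans (add_le_add ha hpow)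
    refine (norm_nsmul_le (n := 2)).trans ?_
    rw [Nat.cast_ofNat]
    gcongr
    exact norm_mul_le_of_le (norm_mul_le_of_le hsub le_rfl) le_rfl
  have hrem : Tendsto (fun n : ℕ => (n : ℝ)⁻¹ • (2 • ((a - a ^ (n + 1)) * b * b))) atTop (𝓝 0) :=
    (tendsto_inv_atTop_nhds_zero_nat (𝕜 := ℝ)).zero_smul_isBoundedUnder_le
      (isBoundedUnder_of ⟨_, hbdd⟩)
  refine (tendsto_const_nhds.sub hrem).congr' ?_ |>.trans_eq (by rw [sub_zero])
  filter_upwards [eventually_ne_atTop 0] with n hn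
  rw [sumPowDist_eq_of_one_sub_mul_eq_one hb, smul_sub, ← Nat.cast_smul_eq_nsmul ℝ n,
    inv_smul_smul₀ (Nat.cast_ne_zero.2 hn)]

variable {𝕜 E : Type*} [NontriviallyNormedField 𝕜] [SeminormedAddCommGroup E] [NormedSpace 𝕜 E]
  {P : E →L[𝕜] E}

theorem norm_pow_apply_sub_le (hP : ‖P‖ ≤ 1) (f : E) (k : ℕ) :
    ‖(P ^ k) f - f‖ ≤ k * ‖P f - f‖ := by
  induction k with
  | zero => simp
  | succ k ih =>
    have hstep : (P ^ (k + 1)) f - f = P ((P ^ k) f - f) + (P f - f) := by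
      rw [pow_succ', mul_apply_eq_comp, map_sub]
      abel
    calc ‖(P ^ (k + 1)) f - f‖ ≤ ‖(P ^ k) f - f‖ + ‖P f - f‖ := by
          rw [hstep]
          exact norm_add_le_of_le ((P.le_of_opNorm_le hP _).trans_eq (one_mul _)) le_rfl
      _ ≤ ((k + 1 : ℕ) : ℝ) * ‖P f - f‖ := by
          rw [Nat.cast_succ]
          linarith

theorem norm_sumPowDist_apply_sub_le (hP : ‖P‖ ≤ 1) (f : E) (n : ℕ) :
    ‖sumPowDist P n f - n ^ 2 • f‖ ≤ n ^ 3 * ‖P f - f‖ := by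
  have hsum : sumPowDist P n f - n ^ 2 • f =
      ∑ i ∈ Finset.range n, ∑ j ∈ Finset.range n, ((P ^ Nat.dist i j) f - f) := by
    simp [sumPowDist, sum_apply, Finset.sum_sub_distrib, pow_two, mul_smul]
  have hterm {i j : ℕ} (hi : i ∈ Finset.range n) (hj : j ∈ Finset.range n) :
      ‖(P ^ Nat.dist i j) f - f‖ ≤ n * ‖P f - f‖ := by
    rw [Finset.mem_range] at hi hj
    refine (norm_pow_apply_sub_le hP f _).trans ?_
    gcongr
    unfold Nat.dist
    lia
  calc ‖sumPowDist P n f - n ^ 2 • f‖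
      ≤ ∑ _i ∈ Finset.range n, ∑ _j ∈ Finset.range n, (n : ℝ) * ‖P f - f‖ := by
        rw [hsum]
        exact norm_sum_le_of_le _ fun _ hi => norm_sum_le_of_le _ fun _ hj => hterm hi hj
    _ = n ^ 3 * ‖P f - f‖ := by
        simp only [Finset.sum_const, Finset.card_range, nsmul_eq_mul]
        ring

end SumPowDist

section RightSpectralGap

open scoped InnerProductSpace

theorem exists_norm_le_of_forall_inner_self_le {𝕜 E ι : Type*} [RCLike 𝕜] [NormedAddCommGroup E]
    [InnerProductSpace 𝕜 E] [CompleteSpace E] {T : ι → E →L[𝕜] E}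
    (hT : ∀ i, (T i : E →ₗ[𝕜] E).IsSymmetric)
    (hbdd : ∀ f, ∃ C : ℝ, ∀ i, ‖⟪T i f, f⟫_𝕜‖ ≤ C) : ∃ K : ℝ, ∀ i, ‖T i‖ ≤ K := by
  choose C hC using hbdd
  have hI (z : 𝕜) : ‖RCLike.I * z‖ ≤ ‖z‖ := by
    rw [norm_mul, RCLike.norm_I]
    split_ifs <;> simp
  have hinner (f g : E) (i : ι) : ‖⟪T i f, g⟫_𝕜‖ ≤ (C (f + g) + C (f - g) +
      C (f + (RCLike.I : 𝕜) • g) + C (f - (RCLike.I : 𝕜) • g)) / 4 := by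
    have hpol := (hT i).inner_map_polarization f g
    simp only [ContinuousLinearMap.coe_coe] at hpol
    rw [hpol, norm_div, RCLike.norm_ofNat]
    gcongr
    exact norm_add_le_of_le (norm_sub_le_of_le (norm_sub_le_of_le (hC _ i) (hC _ i))
      ((hI _).trans (hC _ i))) ((hI _).trans (hC _ i))
  refine banach_steinhaus fun f => ?_
  obtain ⟨K, hK⟩ := banach_steinhaus (g := fun i => innerSL 𝕜 (T i f)) fun g => ⟨_, hinner f g⟩
  exact ⟨K, fun i => by simpa using hK i⟩

variable {E : Type*} [NormedAddCommGroup E] [InnerProductSpace ℝ E] {P P' : E →L[ℝ] E}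

/-- `P` has a right spectral gap: the quadratic form of `1 - P` is bounded below by a positive
multiple of `‖f‖²`. For a self-adjoint `P` this keeps its spectrum away from `1`, but not
from `-1`. -/
def HasRightSpectralGap (P : E →L[ℝ] E) : Prop :=
  ∃ γ : ℝ, 0 < γ ∧ ∀ f : E, γ * ‖f‖ ^ 2 ≤ ⟪f, f - P f⟫_ℝ

theorem norm_apply_sub_sq_le (hP : ‖P‖ ≤ 1) (f : E) : ‖P f - f‖ ^ 2 ≤ 2 * ⟪f, f - P f⟫_ℝ := by
  have hPf : ‖P f‖ ^ 2 ≤ ‖f‖ ^ 2 := by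
    gcongr
    exact (P.le_of_opNorm_le hP f).trans_eq (one_mul _)
  rw [norm_sub_rev, norm_sub_sq_real, inner_sub_right, real_inner_self_eq_norm_sq]
  linarith

theorem HasRightSpectralGap.of_norm_le {c : ℝ} (hP : ‖P‖ ≤ 1)
    (h : ∀ f, ‖f‖ ≤ c * ‖P f - f‖) : HasRightSpectralGap P := by
  refine ⟨(2 * c ^ 2 + 1)⁻¹, by positivity, fun f => ?_⟩
  have hsq := norm_apply_sub_sq_le hP f
  rw [inv_mul_le_iff₀ (by positivity)]
  calc ‖f‖ ^ 2 ≤ (c * ‖P f - f‖) ^ 2 := by gcongr; exact h f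
    _ = c ^ 2 * ‖P f - f‖ ^ 2 := mul_pow _ _ _
    _ ≤ c ^ 2 * (2 * ⟪f, f - P f⟫_ℝ) := by gcongr
    _ ≤ (2 * c ^ 2 + 1) * ⟪f, f - P f⟫_ℝ := by linarith [sq_nonneg ‖P f - f‖]

theorem exists_norm_inv_smul_sumPowDist_le [CompleteSpace E] (hsa : IsSelfAdjoint P)
    (hbdd : ∀ f : E, ∃ C : ℝ, ∀ n : ℕ, |⟪f, sumPowDist P n f⟫_ℝ| ≤ C * n) :
    ∃ K : ℝ, ∀ n : ℕ, ‖(n : ℝ)⁻¹ • sumPowDist P n‖ ≤ K := by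
  refine exists_norm_le_of_forall_inner_self_le (𝕜 := ℝ) (fun n => ?_) fun f => ?_
  · exact ((IsSelfAdjoint.all _).smul (isSelfAdjoint_sumPowDist hsa n)).isSymmetric
  · obtain ⟨C, hC⟩ := hbdd f
    refine ⟨|C|, fun n => ?_⟩
    rw [smul_apply, real_inner_smul_left, real_inner_comm, norm_mul, norm_inv,
      RCLike.norm_natCast, Real.norm_eq_abs]
    refine inv_mul_le_of_le_mul₀ n.cast_nonneg (abs_nonneg C) ((hC n).trans ?_)
    rw [mul_comm]
    gcongr
    exact le_abs_self C

-- Were there no gap, some `f` would be nearly fixed by `P`, and then `⟪f, sumPowDist P n f⟫` would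
-- be about `n² ‖f‖²`, beyond the linear growth allowed by uniform boundedness.
theorem HasRightSpectralGap.of_inner_sumPowDist_le [CompleteSpace E] (hP : ‖P‖ ≤ 1)
    (hsa : IsSelfAdjoint P)
    (hbdd : ∀ f : E, ∃ C : ℝ, ∀ n : ℕ, |⟪f, sumPowDist P n f⟫_ℝ| ≤ C * n) :
    HasRightSpectralGap P := by
  obtain ⟨K, hK⟩ := exists_norm_inv_smul_sumPowDist_le hsa hbdd
  obtain ⟨n, hn⟩ := exists_nat_ge (max K 0 + 1)
  have hn0 : (0 : ℝ) < n := by linarith [le_max_right K 0]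
  refine .of_norm_le (c := n ^ 2) hP fun f => ?_
  have hsmall : ‖sumPowDist P n f‖ ≤ n * (n - 1) * ‖f‖ := by
    have := ((n : ℝ)⁻¹ • sumPowDist P n).le_of_opNorm_le (hK n) f
    rw [smul_apply, norm_smul, norm_inv, RCLike.norm_natCast,
      inv_mul_le_iff₀ hn0] at this
    rw [mul_assoc]
    refine this.trans ?_
    gcongr
    linarith [le_max_left K 0]
  have hclose := norm_sumPowDist_apply_sub_le hP f n
  have hnorm : ‖n ^ 2 • f‖ = n ^ 2 * ‖f‖ := by
    rw [← Nat.cast_smul_eq_nsmul ℝ, norm_smul, RCLike.norm_natCast, Nat.cast_pow]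
  have htri := norm_sub_norm_le (n ^ 2 • f) (sumPowDist P n f)
  rw [norm_sub_rev] at htri
  refine le_of_mul_le_mul_left ?_ hn0
  linarith

theorem HasRightSpectralGap.exists_tendsto_inner_sumPowDist [CompleteSpace E] (hP : ‖P‖ ≤ 1)
    (hgap : HasRightSpectralGap P) (f : E) :
    ∃ v : ℝ, Tendsto (fun n : ℕ => ⟪f, sumPowDist P n f⟫_ℝ / n) atTop (𝓝 v) := by
  obtain ⟨γ, hγ, hgap⟩ := hgap
  have hunit : IsUnit (1 - P) := by
    refine ContinuousLinearMap.isUnit_of_forall_le_norm_inner_map _ (c := ⟨γ, hγ.le⟩) hγ fun f => ?_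
    rw [real_inner_comm, mul_comm]
    exact (hgap f).trans (le_abs_self _)
  obtain ⟨b, hb⟩ := hunit.exists_right_inv
  have hlim := ((ContinuousLinearMap.apply ℝ E f).continuous.tendsto _).comp
    (tendsto_inv_smul_sumPowDist hP hb)
  refine ⟨⟪f, ((1 + P) * b) f⟫_ℝ, (tendsto_const_nhds.inner hlim).congr fun n => ?_⟩
  simp [real_inner_smul_right, div_eq_inv_mul]

theorem HasRightSpectralGap.of_forall_exists_inner_le (hgap : HasRightSpectralGap P)
    (hP' : ‖P'‖ ≤ 1)
    (h : ∀ ε : ℝ, 0 < ε → ∃ c : ℝ≥0, ∀ f : E,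
      ⟪f, f - P f⟫_ℝ ≤ c * ⟪f, f - P' f⟫_ℝ + ε * ‖f‖ ^ 2) :
    HasRightSpectralGap P' := by
  obtain ⟨γ, hγ, hgap⟩ := hgap
  obtain ⟨c, hc⟩ := h (γ / 2) (half_pos hγ)
  refine ⟨γ / (2 * (c + 1)), by positivity, fun f => ?_⟩
  have hnonneg : 0 ≤ ⟪f, f - P' f⟫_ℝ := by
    linarith [norm_apply_sub_sq_le hP' f, sq_nonneg ‖P' f - f‖]
  rw [div_mul_eq_mul_div, div_le_iff₀ (by positivity)]
  linarith [hgap f, hc f]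

end RightSpectralGap

section KernelOperator

open scoped InnerProductSpace

variable {S : Type*} [MeasurableSpace S] {π : Measure S} {P : Kernel S S} [IsMarkovKernel P]

theorem measurePreserving_fst_compProd {T : Type*} [MeasurableSpace T] {κ : Kernel S T}
    [IsMarkovKernel κ] [SFinite π] : MeasurePreserving Prod.fst (π ⊗ₘ κ) π :=
  ⟨measurable_fst, Measure.fst_compProd π κ⟩

theorem measurePreserving_snd_compProd [SFinite π] (hP : P.Invariant π) :
    MeasurePreserving Prod.snd (π ⊗ₘ P) π :=
  ⟨measurable_snd, (Measure.snd_compProd π P).trans hP⟩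

theorem measurePreserving_swap_compProd [IsFiniteMeasure π] (hP : P.IsReversible π) :
    MeasurePreserving Prod.swap (π ⊗ₘ P) (π ⊗ₘ P) := by
  refine ⟨measurable_swap, Measure.ext_prod fun {s t} hs ht => ?_⟩
  rw [Measure.map_apply measurable_swap (hs.prod ht), Set.preimage_swap_prod,
    Measure.compProd_apply_prod ht hs, Measure.compProd_apply_prod hs ht, hP ht hs]

theorem integral_comp_of_measurePreserving {α β E : Type*} [MeasurableSpace α] [MeasurableSpace β]
    [NormedAddCommGroup E] [NormedSpace ℝ E] {μ : Measure α} {ν : Measure β} {φ : α → β}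
    (hφ : MeasurePreserving φ μ ν) {g : β → E} (hg : AEStronglyMeasurable g ν) :
    ∫ x, g (φ x) ∂μ = ∫ y, g y ∂ν := by
  rw [← hφ.map_eq] at hg ⊢
  exact (integral_map hφ.aemeasurable hg).symm

theorem enorm_sq_eq_lintegral {α E : Type*} [MeasurableSpace α] [NormedAddCommGroup E]
    {μ : Measure α} (f : Lp E 2 μ) : ‖f‖ₑ ^ 2 = ∫⁻ x, ‖f x‖ₑ ^ 2 ∂μ := by
  have h := eLpNorm_nnreal_pow_eq_lintegral (f := f) (μ := μ) (two_ne_zero (α := ℝ≥0))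
  simpa [Lp.enorm_def] using h

variable [SFinite π]

/-- The operator `f ↦ ∫ f(y) P(·,dy)` on `L²(π)`, for a Markov kernel `P` with invariant measure
`π`. It is encoded as `J₁* J₂`, where `J₁ f (x, y) = f x` and `J₂ f (x, y) = f y` are the isometric
embeddings of `L²(π)` into `L²` of the law of one transition; see `kernelOp_ae_eq`. -/
noncomputable def kernelOp (hP : P.Invariant π) : Lp ℝ 2 π →L[ℝ] Lp ℝ 2 π :=
  (ContinuousLinearMap.adjoint (Lp.compMeasurePreservingₗᵢ ℝ Prod.fst
    (measurePreserving_fst_compProd (κ := P))).toContinuousLinearMap).comp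
  (Lp.compMeasurePreservingₗᵢ ℝ Prod.snd
    (measurePreserving_snd_compProd hP)).toContinuousLinearMap

theorem inner_kernelOp_eq_inner (hP : P.Invariant π) (f g : Lp ℝ 2 π) :
    ⟪f, kernelOp hP g⟫_ℝ =
      ⟪Lp.compMeasurePreservingₗᵢ ℝ Prod.fst (measurePreserving_fst_compProd (κ := P)) f,
        Lp.compMeasurePreservingₗᵢ ℝ Prod.snd (measurePreserving_snd_compProd hP) g⟫_ℝ := by
  rw [kernelOp, ContinuousLinearMap.comp_apply, ContinuousLinearMap.adjoint_inner_right]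
  rfl

theorem norm_kernelOp_le (hP : P.Invariant π) : ‖kernelOp hP‖ ≤ 1 := by
  refine (ContinuousLinearMap.opNorm_comp_le _ _).trans ?_
  rw [LinearIsometryEquiv.norm_map]
  exact mul_le_one₀ (LinearIsometry.norm_toContinuousLinearMap_le _) (norm_nonneg _)
    (LinearIsometry.norm_toContinuousLinearMap_le _)

theorem inner_kernelOp (hP : P.Invariant π) (f g : Lp ℝ 2 π) :
    ⟪f, kernelOp hP g⟫_ℝ = ∫ z, f z.1 * g z.2 ∂(π ⊗ₘ P) := by
  rw [inner_kernelOp_eq_inner, L2.inner_def]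
  refine integral_congr_ae ?_
  filter_upwards [Lp.coeFn_compMeasurePreserving f (measurePreserving_fst_compProd (κ := P)),
    Lp.coeFn_compMeasurePreserving g (measurePreserving_snd_compProd hP)] with z hfst hsnd
  rw [Real.inner_apply]
  exact congrArg₂ (· * ·) hfst hsnd

theorem isSelfAdjoint_kernelOp [IsFiniteMeasure π] (hP : P.IsReversible π) :
    IsSelfAdjoint (kernelOp hP.invariant) := by
  refine ContinuousLinearMap.isSelfAdjoint_iff_isSymmetric.2 fun f g => ?_
  have hswap := measurePreserving_swap_compProd hP
  rw [ContinuousLinearMap.coe_coe, real_inner_comm, inner_kernelOp, inner_kernelOp,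
    ← hswap.integral_comp MeasurableEquiv.prodComm.measurableEmbedding]
  simp only [Prod.fst_swap, Prod.snd_swap, mul_comm]

theorem kernelOp_ae_eq [IsFiniteMeasure π] (hP : P.Invariant π) (g : Lp ℝ 2 π) :
    kernelOp hP g =ᵐ[π] fun x => ∫ y, g y ∂(P x) := by
  have hsnd : MemLp (fun z : S × S => g z.2) 2 (π ⊗ₘ P) :=
    (Lp.memLp g).comp_measurePreserving (measurePreserving_snd_compProd hP)
  refine Integrable.ae_eq_of_forall_setIntegral_eq _ _ ((Lp.memLp _).integrable one_le_two)
    ((hsnd.integrable one_le_two).integral_compProd (κ := Kernel.const Unit π)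
      (η := Kernel.prodMkLeft Unit P) (a := ())) fun s hs _ => ?_
  have hind : (fun z : S × S => indicatorConstLp 2 hs (measure_ne_top π s) (1 : ℝ) z.1 * g z.2)
      =ᵐ[π ⊗ₘ P] (s ×ˢ Set.univ).indicator fun z => g z.2 := by
    filter_upwards [(measurePreserving_fst_compProd (κ := P)).quasiMeasurePreserving.ae_eq_comp
      (indicatorConstLp_coeFn (p := 2) (hs := hs) (hμs := measure_ne_top π s) (c := (1 : ℝ)))]
      with z hz
    rw [Function.comp_apply, Function.comp_apply] at hz
    by_cases hzs : z.1 ∈ s <;> simp [hz, hzs]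
  calc ∫ x in s, kernelOp hP g x ∂π
      = ⟪indicatorConstLp 2 hs (measure_ne_top π s) (1 : ℝ), kernelOp hP g⟫_ℝ :=
        (L2.inner_indicatorConstLp_one hs (measure_ne_top π s) _).symm
    _ = ∫ z in s ×ˢ Set.univ, g z.2 ∂(π ⊗ₘ P) := by
        rw [inner_kernelOp, integral_congr_ae hind, integral_indicator (hs.prod .univ)]
    _ = ∫ x in s, ∫ y, g y ∂(P x) ∂π := by
        rw [Measure.setIntegral_compProd hs .univ (hsnd.integrable one_le_two).integrableOn]
        simp only [Measure.restrict_univ]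

-- With `J₁`, `J₂` as in `kernelOp`, both sides are `‖J₁ f - J₂ f‖²`.
theorem lintegral_enorm_sub_sq_compProd (hP : P.Invariant π) (f : Lp ℝ 2 π) :
    ∫⁻ z, ‖f z.1 - f z.2‖ₑ ^ 2 ∂(π ⊗ₘ P) = ENNReal.ofReal (2 * ⟪f, f - kernelOp hP f⟫_ℝ) := by
  set f₁ := Lp.compMeasurePreservingₗᵢ ℝ Prod.fst (measurePreserving_fst_compProd (κ := P)) f
    with hf₁
  set f₂ := Lp.compMeasurePreservingₗᵢ ℝ Prod.snd (measurePreserving_snd_compProd hP) f with hf₂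
  have hnorm : ‖f₁ - f₂‖ ^ 2 = 2 * ⟪f, f - kernelOp hP f⟫_ℝ := by
    rw [norm_sub_sq_real, hf₁, hf₂, LinearIsometry.norm_map, LinearIsometry.norm_map,
      inner_sub_right, inner_kernelOp_eq_inner, real_inner_self_eq_norm_sq]
    ring
  have hcoe : (fun z : S × S => f z.1 - f z.2) =ᵐ[π ⊗ₘ P] ⇑(f₁ - f₂) := by
    filter_upwards [Lp.coeFn_compMeasurePreserving f (measurePreserving_fst_compProd (κ := P)),
      Lp.coeFn_compMeasurePreserving f (measurePreserving_snd_compProd hP), Lp.coeFn_sub f₁ f₂]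
      with z hz₁ hz₂ hsub
    exact (hsub.trans (congrArg₂ (· - ·) hz₁ hz₂)).symm
  rw [← hnorm, ENNReal.ofReal_pow (norm_nonneg _), ofReal_norm, enorm_sq_eq_lintegral]
  exact lintegral_congr_ae (hcoe.mono fun z hz => congrArg (‖·‖ₑ ^ 2) hz)

end KernelOperator

section ChainLaw

open scoped InnerProductSpace

variable {S : Type*} [MeasurableSpace S]

theorem measurable_finSnoc (n : ℕ) : Measurable fun z : (Fin n → S) × S =>
    Fin.snoc (α := fun _ => S) z.1 z.2 := by
  refine measurable_pi_iff.2 fun i => ?_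
  cases i using Fin.lastCases with
  | last => simpa only [Fin.snoc_last] using measurable_snd
  | cast j =>
    simp only [Fin.snoc_castSucc]
    fun_prop

theorem measurePreserving_prodMap_compProd_comap {Ω : Type*} [MeasurableSpace Ω] {ν : Measure Ω}
    [SFinite ν] {π : Measure S} [SFinite π] {P : Kernel S S} [IsSFiniteKernel P] {X : Ω → S}
    (hX : MeasurePreserving X ν π) :
    MeasurePreserving (Prod.map X id) (ν ⊗ₘ P.comap X hX.measurable) (π ⊗ₘ P) := by
  have hmeas : Measurable (Prod.map X (id : S → S)) := hX.measurable.prodMap measurable_id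
  refine ⟨hmeas, ?_⟩
  ext s hs
  rw [Measure.map_apply hmeas hs, Measure.compProd_apply (hmeas hs), Measure.compProd_apply hs,
    ← hX.lintegral_comp (Kernel.measurable_kernel_prodMk_left hs)]
  rfl

theorem measurePreserving_finSnoc_chainLaw (P : Kernel S S) (π : Measure S) (n : ℕ) :
    MeasurePreserving (fun z : (Fin (n + 1) → S) × S => Fin.snoc (α := fun _ => S) z.1 z.2)
      (chainLaw P π n ⊗ₘ P.comap (fun x => x (Fin.last n)) (measurable_pi_apply _))
      (chainLaw P π (n + 1)) :=
  ⟨measurable_finSnoc _, rfl⟩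

variable {π : Measure S} [IsProbabilityMeasure π] {P : Kernel S S} [IsMarkovKernel P]

instance isProbabilityMeasure_chainLaw (n : ℕ) : IsProbabilityMeasure (chainLaw P π n) := by
  induction n with
  | zero => exact Measure.isProbabilityMeasure_map (by fun_prop)
  | succ n ih => exact Measure.isProbabilityMeasure_map (measurable_finSnoc _).aemeasurable

theorem measurePreserving_castSucc_chainLaw (n : ℕ) :
    MeasurePreserving (fun (x : Fin (n + 2) → S) (i : Fin (n + 1)) => x i.castSucc)
      (chainLaw P π (n + 1)) (chainLaw P π n) := by
  have hmeas : Measurable fun (x : Fin (n + 2) → S) (i : Fin (n + 1)) => x i.castSucc := by fun_prop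
  refine ⟨hmeas, ?_⟩
  rw [← (measurePreserving_finSnoc_chainLaw P π n).map_eq, Measure.map_map hmeas
    (measurable_finSnoc _)]
  simp only [Function.comp_def, Fin.snoc_castSucc]
  exact Measure.fst_compProd (chainLaw P π n) _

theorem measurePreserving_eval_chainLaw (hP : P.Invariant π) (n : ℕ) (i : Fin (n + 1)) :
    MeasurePreserving (fun x => x i) (chainLaw P π n) π := by
  induction n with
  | zero =>
    refine ⟨measurable_pi_apply i, ?_⟩
    rw [chainLaw, Measure.map_map (measurable_pi_apply i) (by fun_prop)]
    exact Measure.map_id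
  | succ n ih =>
    cases i using Fin.lastCases with
    | last =>
      refine ⟨measurable_pi_apply _, ?_⟩
      rw [← (measurePreserving_finSnoc_chainLaw P π n).map_eq,
        Measure.map_map (measurable_pi_apply _) (measurable_finSnoc _)]
      simpa [Function.comp_def] using ((measurePreserving_snd_compProd hP).comp
        (measurePreserving_prodMap_compProd_comap (P := P) (ih (Fin.last n)))).map_eq
    | cast j => exact (ih j).comp (measurePreserving_castSucc_chainLaw n)

theorem integral_mul_compProd_comap (hP : P.Invariant π) {Ω : Type*} [MeasurableSpace Ω]
    {ν : Measure Ω} [IsFiniteMeasure ν] {X : Ω → S} (hX : MeasurePreserving X ν π) {φ : Ω → ℝ}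
    (hφ : MemLp φ 2 ν) (g : Lp ℝ 2 π) :
    ∫ z, φ z.1 * g z.2 ∂(ν ⊗ₘ P.comap X hX.measurable) = ∫ ω, φ ω * kernelOp hP g (X ω) ∂ν := by
  have hsnd := (measurePreserving_snd_compProd hP).comp
    (measurePreserving_prodMap_compProd_comap (P := P) hX)
  have hintegrable : Integrable (fun z => φ z.1 * g z.2) (ν ⊗ₘ P.comap X hX.measurable) :=
    (hφ.comp_measurePreserving measurePreserving_fst_compProd).integrable_mul
      ((Lp.memLp g).comp_measurePreserving hsnd)
  rw [Measure.integral_compProd hintegrable]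
  refine integral_congr_ae ?_
  filter_upwards [hX.quasiMeasurePreserving.ae_eq_comp (kernelOp_ae_eq hP g)] with ω hω
  rw [Function.comp_apply, Function.comp_apply] at hω
  rw [hω, integral_const_mul, Kernel.comap_apply]

theorem memLp_comp_eval_chainLaw (hP : P.Invariant π) {p : ℝ≥0∞} {h : S → ℝ} (hh : MemLp h p π)
    (n : ℕ) (i : Fin (n + 1)) :
    MemLp (fun x : Fin (n + 1) → S => h (x i)) p (chainLaw P π n) :=
  hh.comp_measurePreserving (measurePreserving_eval_chainLaw hP n i)

theorem integral_mul_eval_chainLaw (hP : P.Invariant π) (f g : Lp ℝ 2 π) (n : ℕ)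
    (i : Fin (n + 1)) : ∫ x, f (x i) * g (x i) ∂(chainLaw P π n) = ⟪f, g⟫_ℝ := by
  rw [integral_comp_of_measurePreserving (g := fun s => f s * g s)
    (measurePreserving_eval_chainLaw hP n i)
    ((Lp.aestronglyMeasurable f).mul (Lp.aestronglyMeasurable g)), L2.inner_def]
  simp only [Real.inner_apply]

theorem integral_mul_chainLaw (hP : P.Invariant π) (f g : Lp ℝ 2 π) (n : ℕ) {i j : Fin (n + 1)}
    (hij : i ≤ j) :
    ∫ x, f (x i) * g (x j) ∂(chainLaw P π n) = ⟪f, (kernelOp hP ^ (j - i : ℕ)) g⟫_ℝ := by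
  have hmeas (g : Lp ℝ 2 π) (n : ℕ) (i j : Fin (n + 1)) :
      AEStronglyMeasurable (fun x : Fin (n + 1) → S => f (x i) * g (x j)) (chainLaw P π n) :=
    (memLp_comp_eval_chainLaw hP (Lp.memLp f) n i).1.mul
      (memLp_comp_eval_chainLaw hP (Lp.memLp g) n j).1
  induction n generalizing g with
  | zero =>
    obtain rfl : i = j := Subsingleton.elim (α := Fin 1) i j
    simpa using integral_mul_eval_chainLaw hP f g 0 i
  | succ n ih =>
    rcases hij.eq_or_lt with rfl | hlt
    · simpa using integral_mul_eval_chainLaw hP f g (n + 1) i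
    obtain ⟨i, rfl⟩ := Fin.exists_castSucc_eq.2 (Fin.ne_last_of_lt hlt)
    cases j using Fin.lastCases with
    | cast j =>
      rw [integral_comp_of_measurePreserving (measurePreserving_castSucc_chainLaw n)
        (hmeas g n i j)]
      exact ih g (Fin.castSucc_le_castSucc_iff.1 hij)
    | last =>
      rw [← integral_comp_of_measurePreserving (measurePreserving_finSnoc_chainLaw P π n)
        (hmeas g _ _ _)]
      simp only [Fin.snoc_castSucc, Fin.snoc_last]
      rw [integral_mul_compProd_comap hP (measurePreserving_eval_chainLaw hP n (Fin.last n))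
        (memLp_comp_eval_chainLaw hP (Lp.memLp f) n i), ih (kernelOp hP g) (Fin.le_last i),
        Fin.val_castSucc, Fin.val_last, Fin.val_last, Nat.succ_sub i.is_le, pow_succ]
      rfl

theorem covariance_chainLaw (hP : P.Invariant π) {h : S → ℝ} (hh : MemLp h 2 π) {f : Lp ℝ 2 π}
    (hf : f =ᵐ[π] fun x => h x - ∫ y, h y ∂π) (n : ℕ) (i j : Fin (n + 1)) :
    cov[fun x => h (x i), fun x => h (x j); chainLaw P π n] =
      ⟪f, (kernelOp hP ^ Nat.dist i j) f⟫_ℝ := by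
  wlog hij : i ≤ j generalizing i j
  · rw [covariance_comm, Nat.dist_comm, this j i (le_of_not_ge hij)]
  have heval := measurePreserving_eval_chainLaw (P := P) hP n
  rw [Nat.dist_eq_sub_of_le hij, ← integral_mul_chainLaw hP f f n hij, covariance]
  refine integral_congr_ae ?_
  filter_upwards [(heval i).quasiMeasurePreserving.ae_eq_comp hf,
    (heval j).quasiMeasurePreserving.ae_eq_comp hf] with x hi hj
  rw [integral_comp_of_measurePreserving (heval i) hh.1,
    integral_comp_of_measurePreserving (heval j) hh.1]
  exact (congrArg₂ (· * ·) hi hj).symm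

theorem variance_sum_chainLaw (hP : P.Invariant π) {h : S → ℝ} (hh : MemLp h 2 π) {f : Lp ℝ 2 π}
    (hf : f =ᵐ[π] fun x => h x - ∫ y, h y ∂π) (n : ℕ) :
    Var[fun x => ∑ i, h (x i); chainLaw P π n] = ⟪f, sumPowDist (kernelOp hP) (n + 1) f⟫_ℝ := by
  rw [variance_fun_sum (memLp_comp_eval_chainLaw hP hh n), sumPowDist]
  simp only [covariance_chainLaw hP hh hf, Finset.sum_range, sum_apply, inner_sum]

theorem scaledVar_eq (hP : P.Invariant π) {h : S → ℝ} (hh : MemLp h 2 π) {f : Lp ℝ 2 π}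
    (hf : f =ᵐ[π] fun x => h x - ∫ y, h y ∂π) (n : ℕ) :
    scaledVar P π h n =
      ENNReal.ofReal (⟪f, sumPowDist (kernelOp hP) (n + 1) f⟫_ℝ / (n + 1 : ℕ)) := by
  have hsum : MemLp (fun x : Fin (n + 1) → S => ((n + 1 : ℕ) : ℝ)⁻¹ * ∑ i, h (x i)) 2
      (chainLaw P π n) :=
    (memLp_finsetSum _ fun i _ => memLp_comp_eval_chainLaw hP hh n i).const_mul _
  rw [scaledVar, ← hsum.ofReal_variance_eq, variance_const_mul, variance_sum_chainLaw hP hh hf,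
    ← ENNReal.ofReal_natCast, ← ENNReal.ofReal_mul (by positivity)]
  congr 1
  field_simp

end ChainLaw

section MeanZero

open scoped InnerProductSpace

variable {S : Type*} [MeasurableSpace S] {π : Measure S} [IsProbabilityMeasure π]

/-- The mean-zero functions in `L²(π)`, encoded as the orthogonal complement of the constants. -/
noncomputable def meanZero (π : Measure S) [IsProbabilityMeasure π] : Submodule ℝ (Lp ℝ 2 π) :=
  (ℝ ∙ indicatorConstLp 2 .univ (measure_ne_top π .univ) (1 : ℝ))ᗮ

theorem mem_meanZero_iff {f : Lp ℝ 2 π} : f ∈ meanZero π ↔ ∫ x, f x ∂π = 0 := by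
  rw [meanZero, Submodule.mem_orthogonal_singleton_iff_inner_right,
    L2.inner_indicatorConstLp_one, Measure.restrict_univ]

theorem coe_meanZero_ae_eq (f : meanZero π) :
    (f : Lp ℝ 2 π) =ᵐ[π] fun x => (f : Lp ℝ 2 π) x - ∫ y, (f : Lp ℝ 2 π) y ∂π := by
  simp [mem_meanZero_iff.1 f.2]

instance completeSpace_meanZero : CompleteSpace (meanZero π) :=
  inferInstanceAs (CompleteSpace (_ : Submodule ℝ (Lp ℝ 2 π))ᗮ)

variable {P : Kernel S S} [IsMarkovKernel P]

theorem kernelOp_mem_meanZero (hP : P.Invariant π) (f : Lp ℝ 2 π) (hf : f ∈ meanZero π) :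
    kernelOp hP f ∈ meanZero π := by
  have hsnd := measurePreserving_snd_compProd hP
  have hintegrable : Integrable (fun z : S × S => f z.2) (π ⊗ₘ P) :=
    ((Lp.memLp f).comp_measurePreserving hsnd).integrable one_le_two
  rw [mem_meanZero_iff] at hf ⊢
  rw [integral_congr_ae (kernelOp_ae_eq hP f), ← Measure.integral_compProd hintegrable,
    integral_comp_of_measurePreserving hsnd (Lp.aestronglyMeasurable f), hf]

/-- The restriction of `kernelOp` to the mean-zero functions, whose right spectral gap is that of
the kernel. -/
noncomputable def meanZeroOp (hP : P.Invariant π) : meanZero π →L[ℝ] meanZero π :=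
  (kernelOp hP).restrict (kernelOp_mem_meanZero hP)

theorem norm_meanZeroOp_le (hP : P.Invariant π) : ‖meanZeroOp hP‖ ≤ 1 :=
  ContinuousLinearMap.opNorm_le_bound _ zero_le_one fun f =>
    (kernelOp hP).le_of_opNorm_le (norm_kernelOp_le hP) f

theorem isSelfAdjoint_meanZeroOp (hP : P.IsReversible π) :
    IsSelfAdjoint (meanZeroOp hP.invariant) :=
  ContinuousLinearMap.isSelfAdjoint_iff_isSymmetric.2 fun f g =>
    ContinuousLinearMap.isSelfAdjoint_iff_isSymmetric.1 (isSelfAdjoint_kernelOp hP) f g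

theorem coe_meanZeroOp_pow_apply (hP : P.Invariant π) (n : ℕ) (f : meanZero π) :
    ((meanZeroOp hP ^ n) f : Lp ℝ 2 π) = (kernelOp hP ^ n) f := by
  induction n generalizing f with
  | zero => rfl
  | succ n ih =>
    rw [pow_succ, pow_succ]
    exact ih (meanZeroOp hP f)

theorem inner_sumPowDist_meanZeroOp (hP : P.Invariant π) (n : ℕ) (f : meanZero π) :
    ⟪f, sumPowDist (meanZeroOp hP) n f⟫_ℝ =
      ⟪(f : Lp ℝ 2 π), sumPowDist (kernelOp hP) n f⟫_ℝ := by
  simp only [sumPowDist, sum_apply, inner_sum, Submodule.coe_inner, coe_meanZeroOp_pow_apply]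

theorem scaledVar_coe_meanZero (hP : P.Invariant π) (f : meanZero π) (n : ℕ) :
    scaledVar P π f n =
      ENNReal.ofReal (⟪f, sumPowDist (meanZeroOp hP) (n + 1) f⟫_ℝ / (n + 1 : ℕ)) := by
  rw [inner_sumPowDist_meanZeroOp, scaledVar_eq hP (Lp.memLp _) (coe_meanZero_ae_eq f)]

theorem exists_scaledVar_eq_coe_meanZero (hP : P.Invariant π) {h : S → ℝ} (hh : MemLp h 2 π) :
    ∃ f : meanZero π, scaledVar P π h = scaledVar P π f := by
  have hsub : MemLp (fun x => h x - ∫ y, h y ∂π) 2 π := hh.sub (memLp_const _)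
  have hmem : hsub.toLp ∈ meanZero π := by
    rw [mem_meanZero_iff, integral_congr_ae hsub.coeFn_toLp,
      integral_sub (hh.integrable one_le_two) (integrable_const _)]
    simp
  refine ⟨⟨hsub.toLp, hmem⟩, funext fun n => ?_⟩
  rw [scaledVar_coe_meanZero hP, inner_sumPowDist_meanZeroOp, scaledVar_eq hP hh hsub.coeFn_toLp]

theorem inner_sumPowDist_meanZeroOp_nonneg (hP : P.Invariant π) (f : meanZero π) (n : ℕ) :
    0 ≤ ⟪f, sumPowDist (meanZeroOp hP) n f⟫_ℝ := by
  cases n with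
  | zero => simp [sumPowDist]
  | succ n =>
    rw [inner_sumPowDist_meanZeroOp,
      ← variance_sum_chainLaw hP (Lp.memLp _) (coe_meanZero_ae_eq f)]
    exact variance_nonneg _ _

theorem VarianceBounding.hasRightSpectralGap (hP : P.IsReversible π)
    (h : VarianceBounding P π) : HasRightSpectralGap (meanZeroOp hP.invariant) := by
  refine .of_inner_sumPowDist_le (norm_meanZeroOp_le _) (isSelfAdjoint_meanZeroOp hP) fun f => ?_
  obtain ⟨v, hv, hlim⟩ := h f (Lp.memLp _)
  obtain ⟨C, hC⟩ := ((ENNReal.tendsto_toReal hv.ne).comp hlim).bddAbove_range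
  refine ⟨C, fun n => ?_⟩
  have hnonneg := inner_sumPowDist_meanZeroOp_nonneg hP.invariant f
  rw [abs_of_nonneg (hnonneg n)]
  cases n with
  | zero => simp [sumPowDist]
  | succ n =>
    have hle : (scaledVar P π f n).toReal ≤ C := hC ⟨n, rfl⟩
    rwa [scaledVar_coe_meanZero hP.invariant,
      ENNReal.toReal_ofReal (div_nonneg (hnonneg _) (by positivity)),
      div_le_iff₀ (by positivity)] at hle

theorem HasRightSpectralGap.varianceBounding {hP : P.Invariant π}
    (h : HasRightSpectralGap (meanZeroOp hP)) : VarianceBounding P π := by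
  intro g hg
  obtain ⟨f, hf⟩ := exists_scaledVar_eq_coe_meanZero hP hg
  obtain ⟨v, hv⟩ := h.exists_tendsto_inner_sumPowDist (norm_meanZeroOp_le hP) f
  refine ⟨ENNReal.ofReal v, ENNReal.ofReal_lt_top, ?_⟩
  rw [HasAsymptoticVariance, hf, funext (scaledVar_coe_meanZero hP f)]
  exact (ENNReal.tendsto_ofReal hv).comp (tendsto_add_atTop_nat 1)

end MeanZero

section ParKernel

open scoped InnerProductSpace

variable {S : Type*} [MeasurableSpace S] {μ : Measure S} {π : S → ℝ≥0} {q : S → S → ℝ≥0}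
  {α α' : S → S → ℝ≥0∞}

instance sFinite_target [SFinite μ] : SFinite (target μ π) :=
  inferInstanceAs (SFinite (μ.withDensity _))

theorem isProbabilityMeasure_target (h : ∫⁻ x, π x ∂μ = 1) : IsProbabilityMeasure (target μ π) :=
  ⟨by rw [target, withDensity_apply _ .univ, Measure.restrict_univ, h]⟩

theorem lintegral_target (hπ : Measurable π) {F : S → ℝ≥0∞} (hF : Measurable F) :
    ∫⁻ x, F x ∂(target μ π) = ∫⁻ x, π x * F x ∂μ :=
  lintegral_withDensity_eq_lintegral_mul _ hπ.coe_nnreal_ennreal hF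

/-- The density `π(x) q(x,y) α(x,y)` of the accepted moves from `x` to `y` in stationarity. -/
noncomputable def flux (π : S → ℝ≥0) (q : S → S → ℝ≥0) (α : S → S → ℝ≥0∞) (x y : S) : ℝ≥0∞ :=
  π x * (q x y * α x y)

/-- The part of the law of one stationary transition that comes from accepted moves. -/
noncomputable def fluxMeasure (μ : Measure S) (π : S → ℝ≥0) (q : S → S → ℝ≥0)
    (α : S → S → ℝ≥0∞) : Measure (S × S) :=
  (μ.prod μ).withDensity (Function.uncurry (flux π q α))

theorem measurable_proposal_mul (hq : Measurable (Function.uncurry q))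
    (hα : Measurable (Function.uncurry α)) :
    Measurable (Function.uncurry fun x y => (q x y : ℝ≥0∞) * α x y) :=
  hq.coe_nnreal_ennreal.mul hα

theorem measurable_flux (hπ : Measurable π) (hq : Measurable (Function.uncurry q))
    (hα : Measurable (Function.uncurry α)) : Measurable (Function.uncurry (flux π q α)) :=
  (hπ.comp measurable_fst).coe_nnreal_ennreal.mul (measurable_proposal_mul hq hα)

variable [SFinite μ]

theorem lintegral_parKernel (hq : Measurable (Function.uncurry q))
    (hα : Measurable (Function.uncurry α)) {F : S → ℝ≥0∞} (hF : Measurable F) (x : S) :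
    ∫⁻ y, F y ∂(parKernel μ q α x) =
      ∫⁻ y, q x y * α x y * F y ∂μ + (1 - ∫⁻ y, q x y * α x y ∂μ) * F x := by
  have hqα := measurable_proposal_mul hq hα
  have hrej : Measurable (Function.uncurry fun x (_ : S) => 1 - ∫⁻ y, q x y * α x y ∂μ) :=
    (measurable_const.sub hqα.lintegral_prod_right').comp measurable_fst
  rw [parKernel, add_apply, lintegral_add_measure, Kernel.lintegral_withDensity _ hqα x hF,
    Kernel.lintegral_withDensity _ hrej x hF, Kernel.const_apply, Kernel.id_apply,
    lintegral_const_mul _ hF, lintegral_dirac' _ hF]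

theorem isMarkovKernel_parKernel (hq : Measurable (Function.uncurry q))
    (hα : Measurable (Function.uncurry α)) (hα_le : ∀ x y, α x y ≤ 1)
    (hq_one : ∀ x, ∫⁻ y, q x y ∂μ = 1) : IsMarkovKernel (parKernel μ q α) := by
  refine ⟨fun x => ⟨?_⟩⟩
  have hacc : ∫⁻ y, q x y * α x y ∂μ ≤ 1 :=
    (lintegral_mono fun y => mul_le_of_le_one_right' (hα_le x y)).trans_eq (hq_one x)
  rw [← lintegral_one, lintegral_parKernel hq hα measurable_const]
  simpa only [mul_one] using add_tsub_cancel_of_le hacc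

theorem lintegral_fluxMeasure (hπ : Measurable π) (hq : Measurable (Function.uncurry q))
    (hα : Measurable (Function.uncurry α)) {F : S × S → ℝ≥0∞} (hF : Measurable F) :
    ∫⁻ z, F z ∂(fluxMeasure μ π q α) =
      ∫⁻ x, ∫⁻ y, q x y * α x y * F (x, y) ∂μ ∂(target μ π) := by
  have hqα : Measurable fun z : S × S => (q z.1 z.2 : ℝ≥0∞) * α z.1 z.2 * F z :=
    (measurable_proposal_mul hq hα).mul hF
  have hflux := measurable_flux hπ hq hα
  rw [fluxMeasure, lintegral_withDensity_eq_lintegral_mul _ hflux hF,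
    lintegral_prod _ (hflux.mul hF).aemeasurable, lintegral_target hπ hqα.lintegral_prod_right']
  refine lintegral_congr fun x => ?_
  have hqαx : Measurable fun y => (q x y : ℝ≥0∞) * α x y * F (x, y) :=
    hqα.comp measurable_prodMk_left
  rw [← lintegral_const_mul _ hqαx]
  simp only [Pi.mul_apply, Function.uncurry_apply_pair, flux, mul_assoc]

theorem lintegral_target_compProd_parKernel [IsMarkovKernel (parKernel μ q α)] (hπ : Measurable π)
    (hq : Measurable (Function.uncurry q)) (hα : Measurable (Function.uncurry α))
    {F : S × S → ℝ≥0∞} (hF : Measurable F) :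
    ∫⁻ z, F z ∂(target μ π ⊗ₘ parKernel μ q α) = ∫⁻ z, F z ∂(fluxMeasure μ π q α) +
      ∫⁻ x, (1 - ∫⁻ y, q x y * α x y ∂μ) * F (x, x) ∂(target μ π) := by
  have hqα : Measurable fun z : S × S => (q z.1 z.2 : ℝ≥0∞) * α z.1 z.2 * F z :=
    (measurable_proposal_mul hq hα).mul hF
  rw [Measure.lintegral_compProd hF, lintegral_fluxMeasure hπ hq hα hF,
    ← lintegral_add_left hqα.lintegral_prod_right']
  exact lintegral_congr fun x => lintegral_parKernel hq hα (hF.comp measurable_prodMk_left) x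

theorem measurePreserving_swap_fluxMeasure (hπ : Measurable π)
    (hq : Measurable (Function.uncurry q)) (hα : Measurable (Function.uncurry α))
    (hsymm : ∀ x y, flux π q α x y = flux π q α y x) :
    MeasurePreserving Prod.swap (fluxMeasure μ π q α) (fluxMeasure μ π q α) := by
  refine ⟨measurable_swap, Measure.ext_of_lintegral _ fun F hF => ?_⟩
  have hflux := measurable_flux hπ hq hα
  have hFswap : Measurable fun z : S × S => F z.swap := hF.comp measurable_swap
  rw [lintegral_map hF measurable_swap, fluxMeasure,
    lintegral_withDensity_eq_lintegral_mul _ hflux hF,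
    lintegral_withDensity_eq_lintegral_mul _ hflux hFswap, ← lintegral_prod_swap]
  exact lintegral_congr fun z => congrArg (· * F z) (hsymm z.2 z.1)

theorem isReversible_parKernel [IsMarkovKernel (parKernel μ q α)] (hπ : Measurable π)
    (hq : Measurable (Function.uncurry q)) (hα : Measurable (Function.uncurry α))
    (hsymm : ∀ x y, flux π q α x y = flux π q α y x) :
    (parKernel μ q α).IsReversible (target μ π) := by
  intro s t hs ht
  have hind : Measurable ((t ×ˢ s).indicator (1 : S × S → ℝ≥0∞)) :=
    measurable_one.indicator (ht.prod hs)
  have hind_swap : Measurable fun z : S × S => (t ×ˢ s).indicator (1 : S × S → ℝ≥0∞) z.swap :=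
    hind.comp measurable_swap
  have hswap (z : S × S) : (s ×ˢ t).indicator (1 : S × S → ℝ≥0∞) z =
      (t ×ˢ s).indicator 1 z.swap := by
    rw [← Set.preimage_swap_prod]
    rfl
  rw [← Measure.compProd_apply_prod hs ht, ← Measure.compProd_apply_prod ht hs,
    ← lintegral_indicator_one (hs.prod ht), ← lintegral_indicator_one (ht.prod hs),
    lintegral_target_compProd_parKernel hπ hq hα hind, lintegral_congr hswap,
    lintegral_target_compProd_parKernel hπ hq hα hind_swap,
    (measurePreserving_swap_fluxMeasure hπ hq hα hsymm).lintegral_comp hind]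
  rfl

theorem lintegral_fluxMeasure_enorm_sub_sq [IsMarkovKernel (parKernel μ q α)]
    (hπ : Measurable π) (hq : Measurable (Function.uncurry q))
    (hα : Measurable (Function.uncurry α)) (hP : (parKernel μ q α).Invariant (target μ π))
    (f : Lp ℝ 2 (target μ π)) :
    ∫⁻ z, ‖f z.1 - f z.2‖ₑ ^ 2 ∂(fluxMeasure μ π q α) =
      ENNReal.ofReal (2 * ⟪f, f - kernelOp hP f⟫_ℝ) := by
  have hf : Measurable f := (Lp.stronglyMeasurable f).measurable
  have hmeas : Measurable fun z : S × S => ‖f z.1 - f z.2‖ₑ ^ 2 :=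
    ((hf.comp measurable_fst).sub (hf.comp measurable_snd)).enorm.pow_const 2
  rw [← lintegral_enorm_sub_sq_compProd, lintegral_target_compProd_parKernel hπ hq hα hmeas]
  simp

end ParKernel

section FluxComparison

open scoped InnerProductSpace

theorem enorm_sub_sq_le {E : Type*} [SeminormedAddCommGroup E] (a b : E) :
    ‖a - b‖ₑ ^ 2 ≤ 2 * (‖a‖ₑ ^ 2 + ‖b‖ₑ ^ 2) := by
  calc ‖a - b‖ₑ ^ 2 ≤ (‖a‖ₑ + ‖b‖ₑ) ^ 2 := by gcongr; exact enorm_sub_le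
    _ ≤ 2 * (‖a‖ₑ ^ 2 + ‖b‖ₑ ^ 2) := by
      simp only [enorm_eq_nnnorm]
      exact_mod_cast add_sq_le (a := ‖a‖₊) (b := ‖b‖₊)

theorem lintegral_enorm_sub_sq_le_of_measurePreserving_swap {S E : Type*} [MeasurableSpace S]
    [NormedAddCommGroup E] [MeasurableSpace E] [OpensMeasurableSpace E] {ρ : Measure (S × S)}
    (hρ : MeasurePreserving Prod.swap ρ ρ) {f : S → E} (hf : Measurable f) :
    ∫⁻ z, ‖f z.1 - f z.2‖ₑ ^ 2 ∂ρ ≤ 4 * ∫⁻ z, ‖f z.1‖ₑ ^ 2 ∂ρ := by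
  have hfst : Measurable fun z : S × S => ‖f z.1‖ₑ ^ 2 := by fun_prop
  have hsnd : ∫⁻ z, ‖f z.2‖ₑ ^ 2 ∂ρ = ∫⁻ z, ‖f z.1‖ₑ ^ 2 ∂ρ := hρ.lintegral_comp hfst
  calc ∫⁻ z, ‖f z.1 - f z.2‖ₑ ^ 2 ∂ρ
      ≤ ∫⁻ z, 2 * (‖f z.1‖ₑ ^ 2 + ‖f z.2‖ₑ ^ 2) ∂ρ := lintegral_mono fun _ => enorm_sub_sq_le _ _
    _ = 4 * ∫⁻ z, ‖f z.1‖ₑ ^ 2 ∂ρ := by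
      rw [lintegral_const_mul' _ _ ENNReal.ofNat_ne_top, lintegral_add_left hfst, hsnd]
      ring

variable {S : Type*} [MeasurableSpace S] {μ : Measure S} {π : S → ℝ≥0} {q : S → S → ℝ≥0}
  {α α' : S → S → ℝ≥0∞}

theorem lintegral_fluxMeasure_le_add (hπ : Measurable π) (hq : Measurable (Function.uncurry q))
    (hα : Measurable (Function.uncurry α)) (hα' : Measurable (Function.uncurry α')) (c : ℝ≥0∞)
    {F : S × S → ℝ≥0∞} (hF : Measurable F) :
    ∫⁻ z, F z ∂(fluxMeasure μ π q α) ≤ c * ∫⁻ z, F z ∂(fluxMeasure μ π q α') +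
      ∫⁻ z in {z | c * flux π q α' z.1 z.2 < flux π q α z.1 z.2}, F z ∂(fluxMeasure μ π q α) := by
  have hflux := measurable_flux hπ hq hα
  have hflux' := measurable_flux hπ hq hα'
  have hB : MeasurableSet {z : S × S | c * flux π q α' z.1 z.2 < flux π q α z.1 z.2} :=
    measurableSet_lt (hflux'.const_mul c) hflux
  rw [← lintegral_add_compl F hB, add_comm]
  gcongr
  rw [fluxMeasure, fluxMeasure, setLIntegral_withDensity_eq_setLIntegral_mul _ hflux hF hB.compl,
    lintegral_withDensity_eq_lintegral_mul _ hflux' hF, ← lintegral_const_mul _ (hflux'.mul hF)]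
  refine (setLIntegral_mono ((hflux'.mul hF).const_mul c) fun z hz => ?_).trans
    (setLIntegral_le_lintegral _ _)
  rw [Pi.mul_apply, Pi.mul_apply, ← mul_assoc]
  exact mul_le_mul_left (not_lt.1 fun h => hz h) _

variable [SFinite μ]

theorem setLIntegral_fluxMeasure_le (hπ : Measurable π) (hq : Measurable (Function.uncurry q))
    (hα : Measurable (Function.uncurry α)) (hα_le : ∀ x y, α x y ≤ 1) {B : Set (S × S)}
    (hB : MeasurableSet B) {C : ℝ≥0∞}
    (hqB : ∀ᵐ x ∂(target μ π), ∫⁻ y in {y | (x, y) ∈ B}, q x y ∂μ ≤ C) {g : S → ℝ≥0∞}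
    (hg : Measurable g) :
    ∫⁻ z in B, g z.1 ∂(fluxMeasure μ π q α) ≤ C * ∫⁻ x, g x ∂(target μ π) := by
  have hgB : Measurable (B.indicator fun z => g z.1) := (hg.comp measurable_fst).indicator hB
  rw [← lintegral_indicator hB, lintegral_fluxMeasure hπ hq hα hgB, ← lintegral_const_mul _ hg]
  refine lintegral_mono_ae (hqB.mono fun x hx => ?_)
  have hBx : MeasurableSet {y | (x, y) ∈ B} := measurable_prodMk_left hB
  have hqx : Measurable fun y => (q x y : ℝ≥0∞) :=
    hq.coe_nnreal_ennreal.comp measurable_prodMk_left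
  calc ∫⁻ y, q x y * α x y * B.indicator (fun z => g z.1) (x, y) ∂μ
      ≤ ∫⁻ y, {y | (x, y) ∈ B}.indicator (fun y => (q x y : ℝ≥0∞)) y * g x ∂μ := by
        refine lintegral_mono fun y => ?_
        by_cases hy : (x, y) ∈ B
        · simpa [hy] using mul_le_mul_left (mul_le_of_le_one_right' (hα_le x y)) (g x)
        · simp [hy]
    _ = (∫⁻ y in {y | (x, y) ∈ B}, q x y ∂μ) * g x := by
        rw [lintegral_mul_const _ (hqx.indicator hBx), lintegral_indicator hBx]
    _ ≤ C * g x := by gcongr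

theorem lintegral_fluxMeasure_enorm_sub_sq_le (hπ : Measurable π)
    (hq : Measurable (Function.uncurry q)) (hα : Measurable (Function.uncurry α))
    (hα_le : ∀ x y, α x y ≤ 1) (hsymm : ∀ x y, flux π q α x y = flux π q α y x)
    (hα' : Measurable (Function.uncurry α'))
    (hsymm' : ∀ x y, flux π q α' x y = flux π q α' y x) {c C : ℝ≥0∞}
    (hqB : ∀ᵐ x ∂(target μ π), ∫⁻ y in {y | c * flux π q α' x y < flux π q α x y}, q x y ∂μ ≤ C)
    {f : S → ℝ} (hf : Measurable f) :
    ∫⁻ z, ‖f z.1 - f z.2‖ₑ ^ 2 ∂(fluxMeasure μ π q α) ≤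
      c * ∫⁻ z, ‖f z.1 - f z.2‖ₑ ^ 2 ∂(fluxMeasure μ π q α') +
        4 * (C * ∫⁻ x, ‖f x‖ₑ ^ 2 ∂(target μ π)) := by
  set B := {z : S × S | c * flux π q α' z.1 z.2 < flux π q α z.1 z.2} with hB_def
  have hB : MeasurableSet B :=
    measurableSet_lt ((measurable_flux hπ hq hα').const_mul c) (measurable_flux hπ hq hα)
  have hB_swap : Prod.swap ⁻¹' B = B := by
    ext z
    simp only [hB_def, Set.mem_preimage, Set.mem_ofPred_eq, Prod.fst_swap, Prod.snd_swap,
      hsymm z.1, hsymm' z.1]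
  have hswap : MeasurePreserving Prod.swap ((fluxMeasure μ π q α).restrict B)
      ((fluxMeasure μ π q α).restrict B) := by
    simpa only [hB_swap] using
      (measurePreserving_swap_fluxMeasure hπ hq hα hsymm).restrict_preimage hB
  refine (lintegral_fluxMeasure_le_add hπ hq hα hα' c (by fun_prop)).trans ?_
  gcongr
  refine (lintegral_enorm_sub_sq_le_of_measurePreserving_swap hswap hf).trans ?_
  gcongr
  exact setLIntegral_fluxMeasure_le hπ hq hα hα_le hB hqB (by fun_prop)

theorem inner_sub_kernelOp_parKernel_le [IsMarkovKernel (parKernel μ q α)]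
    [IsMarkovKernel (parKernel μ q α')] (hπ : Measurable π)
    (hq : Measurable (Function.uncurry q)) (hα : Measurable (Function.uncurry α))
    (hα_le : ∀ x y, α x y ≤ 1) (hsymm : ∀ x y, flux π q α x y = flux π q α y x)
    (hα' : Measurable (Function.uncurry α'))
    (hsymm' : ∀ x y, flux π q α' x y = flux π q α' y x)
    (hP : (parKernel μ q α).Invariant (target μ π))
    (hP' : (parKernel μ q α').Invariant (target μ π)) {c : ℝ≥0} {ε : ℝ} (hε : 0 ≤ ε)
    (hqB : ∀ᵐ x ∂(target μ π),
      ∫⁻ y in {y | c * flux π q α' x y < flux π q α x y}, q x y ∂μ ≤ ENNReal.ofReal ε)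
    (f : Lp ℝ 2 (target μ π)) :
    ⟪f, f - kernelOp hP f⟫_ℝ ≤ c * ⟪f, f - kernelOp hP' f⟫_ℝ + 2 * ε * ‖f‖ ^ 2 := by
  have hle := lintegral_fluxMeasure_enorm_sub_sq_le hπ hq hα hα_le hsymm hα' hsymm' hqB
    (Lp.stronglyMeasurable f).measurable
  have hnonneg : 0 ≤ 2 * ⟪f, f - kernelOp hP' f⟫_ℝ :=
    (sq_nonneg _).trans (norm_apply_sub_sq_le (norm_kernelOp_le hP') f)
  rw [lintegral_fluxMeasure_enorm_sub_sq hπ hq hα hP,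
    lintegral_fluxMeasure_enorm_sub_sq hπ hq hα' hP', ← enorm_sq_eq_lintegral, ← ofReal_norm,
    ← ENNReal.ofReal_pow (norm_nonneg _), ← ENNReal.ofReal_coe_nnreal, ← ENNReal.ofReal_ofNat 4,
    ← ENNReal.ofReal_mul (by positivity), ← ENNReal.ofReal_mul (by positivity),
    ← ENNReal.ofReal_mul (by positivity), ← ENNReal.ofReal_add (by positivity) (by positivity),
    ENNReal.ofReal_le_ofReal_iff (by positivity)] at hle
  linarith

theorem VarianceBounding.of_flux_le (hπ : Measurable π) (hπ_one : ∫⁻ x, π x ∂μ = 1)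
    (hq : Measurable (Function.uncurry q)) (hq_one : ∀ x, ∫⁻ y, q x y ∂μ = 1)
    (hα : Measurable (Function.uncurry α)) (hα_le : ∀ x y, α x y ≤ 1)
    (hsymm : ∀ x y, flux π q α x y = flux π q α y x)
    (hα' : Measurable (Function.uncurry α')) (hα'_le : ∀ x y, α' x y ≤ 1)
    (hsymm' : ∀ x y, flux π q α' x y = flux π q α' y x)
    (hcond : ∀ ε : ℝ, 0 < ε → ∃ c : ℝ≥0, ∀ᵐ x ∂(target μ π),
      ∫⁻ y in {y | c * flux π q α' x y < flux π q α x y}, q x y ∂μ ≤ ENNReal.ofReal ε)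
    (h : VarianceBounding (parKernel μ q α) (target μ π)) :
    VarianceBounding (parKernel μ q α') (target μ π) := by
  have := isProbabilityMeasure_target hπ_one
  have := isMarkovKernel_parKernel hq hα hα_le hq_one
  have := isMarkovKernel_parKernel hq hα' hα'_le hq_one
  have hP := isReversible_parKernel (μ := μ) hπ hq hα hsymm
  have hP' := isReversible_parKernel (μ := μ) hπ hq hα' hsymm'
  have hgap' : HasRightSpectralGap (meanZeroOp hP'.invariant) := by
    refine (h.hasRightSpectralGap hP).of_forall_exists_inner_le (norm_meanZeroOp_le _)
      fun ε hε => (hcond (ε / 2) (half_pos hε)).imp fun c hc f => ?_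
    have hle := inner_sub_kernelOp_parKernel_le hπ hq hα hα_le hsymm hα' hsymm' hP.invariant
      hP'.invariant (half_pos hε).le hc f
    rwa [mul_div_cancel₀ ε two_ne_zero] at hle
  exact hgap'.varianceBounding

end FluxComparison

section ExtendedRatios

theorem mul_min_one_div {a : ℝ≥0∞} (ha : a ≠ ∞) (b : ℝ≥0∞) : a * min 1 (b / a) = min a b := by
  rcases eq_or_ne a 0 with rfl | ha₀
  · simp
  · rw [mul_min, mul_one, ENNReal.mul_div_cancel ha₀ ha]

theorem min_one_mul_le_max_one_mul_min_one (r s : ℝ≥0∞) :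
    min 1 (r * s) ≤ max 1 r * min 1 s := by
  rw [mul_min, mul_one]
  exact min_le_min (le_max_left 1 r) (mul_le_mul_left (le_max_right 1 r) s)

theorem min_one_mul_le_mul_min_one {r s : ℝ≥0∞}
    (h : 0 ≤ SignType.sign (ENNReal.log r) * SignType.sign (ENNReal.log s)) :
    min 1 (r * s) ≤ min 1 r * min 1 s := by
  rcases lt_trichotomy r 1 with hr | rfl | hr
  · have hs : s ≤ 1 := by
      by_contra! hs
      rw [sign_neg (ENNReal.log_lt_zero_iff.2 hr), sign_pos (ENNReal.zero_lt_log_iff.2 hs)] at h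
      exact absurd h (by decide)
    rw [min_eq_right hr.le, min_eq_right hs]
    exact min_le_right _ _
  · simp
  · have hs : 1 ≤ s := by
      by_contra! hs
      rw [sign_pos (ENNReal.zero_lt_log_iff.2 hr), sign_neg (ENNReal.log_lt_zero_iff.2 hs)] at h
      exact absurd h (by decide)
    rw [min_eq_left hr.le, min_eq_left hs, one_mul]
    exact min_le_left _ _

theorem max_one_le_exp_mul_min_one {r : ℝ≥0∞} {m : ℝ}
    (h : ((ENNReal.log r).abs : EReal) ≤ m) :
    max 1 r ≤ ENNReal.ofReal (Real.exp m) * min 1 r := by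
  obtain ⟨x, rfl⟩ := EReal.expOrderIso.surjective r
  simp only [EReal.expOrderIso_apply, EReal.log_exp] at h ⊢
  induction x with
  | bot => simp at h
  | top => simp at h
  | coe x =>
    obtain ⟨hneg, hpos⟩ : -m ≤ x ∧ x ≤ m := by
      rw [EReal.abs_def, EReal.coe_ennreal_ofReal, max_eq_left (abs_nonneg x)] at h
      exact abs_le.1 (EReal.coe_le_coe_iff.1 h)
    have hone : 1 ≤ ENNReal.ofReal (Real.exp m) := by
      rw [ENNReal.one_le_ofReal]
      exact Real.one_le_exp (by linarith)
    have hinv : 1 ≤ ENNReal.ofReal (Real.exp m) * ENNReal.ofReal (Real.exp x) := by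
      rw [← ENNReal.ofReal_mul (Real.exp_nonneg m), ← Real.exp_add, ENNReal.one_le_ofReal]
      exact Real.one_le_exp (by linarith)
    have hle : ENNReal.ofReal (Real.exp x) ≤ ENNReal.ofReal (Real.exp m) := by gcongr
    rw [EReal.exp_coe, mul_min, mul_one]
    exact max_le (le_min hone hinv) (le_min hle (le_mul_of_one_le_left' hone))

theorem min_one_mul_le_exp_mul {r s : ℝ≥0∞} {m : ℝ}
    (h : (m : EReal) < ((min (ENNReal.log r).abs (ENNReal.log s).abs : ℝ≥0∞) : EReal) →
      0 ≤ SignType.sign (ENNReal.log r) * SignType.sign (ENNReal.log s)) :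
    min 1 (r * s) ≤ ENNReal.ofReal (Real.exp |m|) * (min 1 r * min 1 s) := by
  have hbound {a b : ℝ≥0∞} (ha : ((ENNReal.log a).abs : EReal) ≤ m) :
      min 1 (a * b) ≤ ENNReal.ofReal (Real.exp |m|) * (min 1 a * min 1 b) := by
    rw [← mul_assoc]
    refine (min_one_mul_le_max_one_mul_min_one a b).trans ?_
    gcongr
    exact max_one_le_exp_mul_min_one (ha.trans (EReal.coe_le_coe_iff.2 (le_abs_self m)))
  by_cases hm : (m : EReal) < ((min (ENNReal.log r).abs (ENNReal.log s).abs : ℝ≥0∞) : EReal)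
  · refine (min_one_mul_le_mul_min_one (h hm)).trans (le_mul_of_one_le_left' ?_)
    exact ENNReal.one_le_ofReal.2 (Real.one_le_exp (abs_nonneg m))
  · rcases min_choice (ENNReal.log r).abs (ENNReal.log s).abs with hmin | hmin <;>
      rw [hmin, not_lt] at hm
    · exact hbound hm
    · rw [mul_comm r, mul_comm (min 1 r)]
      exact hbound hm

end ExtendedRatios

section Acceptance

variable {S : Type*} {π πhat : S → ℝ≥0} {q : S → S → ℝ≥0}

theorem flux_alphaMH (x y : S) :
    flux π q (alphaMH π q) x y = min ((π x : ℝ≥0∞) * q x y) ((π y : ℝ≥0∞) * q y x) := by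
  rw [flux, alphaMH, rMH, ← mul_assoc, mul_min_one_div (by finiteness)]

theorem flux_alphaMH_symm (x y : S) :
    flux π q (alphaMH π q) x y = flux π q (alphaMH π q) y x := by
  rw [flux_alphaMH, flux_alphaMH, min_comm]

theorem flux_alphaDA (hpos : ∀ x, 0 < π x → 0 < πhat x) (x y : S) :
    flux π q (alphaDA π πhat q) x y =
      min ((πhat x : ℝ≥0∞) * q x y) ((πhat y : ℝ≥0∞) * q y x) *
        min ((π x : ℝ≥0∞) / πhat x) ((π y : ℝ≥0∞) / πhat y) := by
  have hzero : (πhat x : ℝ≥0∞) = 0 → (π x : ℝ≥0∞) = 0 := by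
    simpa [pos_iff_ne_zero, not_imp_not] using hpos x
  have hw : (π x : ℝ≥0∞) / πhat x ≠ ∞ := by
    simpa [ENNReal.div_eq_top] using mt (hzero ∘ ENNReal.coe_eq_zero.2)
  have hfactor : (πhat x : ℝ≥0∞) * (π x / πhat x) = π x :=
    ENNReal.mul_div_cancel' hzero fun h => absurd h ENNReal.coe_ne_top
  rw [flux, alphaDA, rDA₁, rDA₂, ← mul_min_one_div (a := (πhat x : ℝ≥0∞) * q x y) (by finiteness),
    ← mul_min_one_div hw]
  nth_rw 1 [← hfactor]
  ring

theorem flux_alphaDA_symm (hpos : ∀ x, 0 < π x → 0 < πhat x) (x y : S) :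
    flux π q (alphaDA π πhat q) x y = flux π q (alphaDA π πhat q) y x := by
  rw [flux_alphaDA hpos, flux_alphaDA hpos, min_comm, min_comm ((π x : ℝ≥0∞) / πhat x)]

theorem rMH_eq_rDA₁_mul_rDA₂ (hpos : ∀ x, 0 < π x → 0 < πhat x) {x : S} (hx : π x ≠ 0) (y : S) :
    rMH π q x y = rDA₁ πhat q x y * rDA₂ π πhat x y := by
  rcases eq_or_ne (π y) 0 with hy | hy
  · simp [rMH, rDA₂, hy]
  have hx' : (πhat x : ℝ≥0∞) ≠ 0 := by exact_mod_cast (hpos x (pos_iff_ne_zero.2 hx)).ne'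
  have hy' : (πhat y : ℝ≥0∞) ≠ 0 := by exact_mod_cast (hpos y (pos_iff_ne_zero.2 hy)).ne'
  have hcancel : (πhat y * (πhat y : ℝ≥0∞)⁻¹) * (πhat x * (πhat x : ℝ≥0∞)⁻¹) = 1 := by
    rw [ENNReal.mul_inv_cancel hx' ENNReal.coe_ne_top,
      ENNReal.mul_inv_cancel hy' ENNReal.coe_ne_top, one_mul]
  have hx₀ : (π x : ℝ≥0∞) ≠ 0 := by exact_mod_cast hx
  calc rMH π q x y
      = rMH π q x y * (πhat y * (πhat y : ℝ≥0∞)⁻¹ * (πhat x * (πhat x : ℝ≥0∞)⁻¹)) := by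
        rw [hcancel, mul_one]
    _ = rDA₁ πhat q x y * rDA₂ π πhat x y := by
        simp only [rMH, rDA₁, rDA₂, div_eq_mul_inv, inv_inv, hx', hx₀, ENNReal.mul_inv,
          ne_eq, ENNReal.coe_ne_top, not_false_eq_true, true_or, or_true, ENNReal.inv_ne_top,
          ENNReal.inv_eq_zero]
        ring

theorem flux_alphaMH_le_exp_mul (hpos : ∀ x, 0 < π x → 0 < πhat x) {m : ℝ} {x y : S}
    (h : y ∈ potentialProblemSet π πhat q m x → y ∈ noProblemSet π πhat q x) :
    flux π q (alphaMH π q) x y ≤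
      ENNReal.ofReal (Real.exp |m|) * flux π q (alphaDA π πhat q) x y := by
  rcases eq_or_ne (π x) 0 with hx | hx
  · simp [flux, hx]
  calc flux π q (alphaMH π q) x y
      = π x * (q x y * min 1 (rDA₁ πhat q x y * rDA₂ π πhat x y)) := by
        rw [flux, alphaMH, rMH_eq_rDA₁_mul_rDA₂ hpos hx]
    _ ≤ π x * (q x y * (ENNReal.ofReal (Real.exp |m|) * alphaDA π πhat q x y)) := by
        gcongr
        exact min_one_mul_le_exp_mul h
    _ = ENNReal.ofReal (Real.exp |m|) * flux π q (alphaDA π πhat q) x y := by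
        rw [flux]
        ring

variable [MeasurableSpace S]

theorem measurable_alphaMH (hπ : Measurable π) (hq : Measurable (Function.uncurry q)) :
    Measurable (Function.uncurry (alphaMH π q)) := by
  have hq₁ : Measurable fun z : S × S => (q z.1 z.2 : ℝ≥0∞) := hq.coe_nnreal_ennreal
  have hq₂ : Measurable fun z : S × S => (q z.2 z.1 : ℝ≥0∞) := hq₁.comp measurable_swap
  exact measurable_const.min (((hπ.comp measurable_snd).coe_nnreal_ennreal.mul hq₂).div
    ((hπ.comp measurable_fst).coe_nnreal_ennreal.mul hq₁))

theorem measurable_alphaDA (hπ : Measurable π) (hπhat : Measurable πhat)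
    (hq : Measurable (Function.uncurry q)) :
    Measurable (Function.uncurry (alphaDA π πhat q)) := by
  have hw : Measurable fun x => (π x : ℝ≥0∞) / πhat x :=
    hπ.coe_nnreal_ennreal.div hπhat.coe_nnreal_ennreal
  exact (measurable_alphaMH hπhat hq).mul
    (measurable_const.min ((hw.comp measurable_snd).div (hw.comp measurable_fst)))

end Acceptance

end DelayedAcceptance

theorem corollary1_general {S : Type*} [MeasurableSpace S] {μ : Measure S} [SFinite μ]
    {π πhat : S → ℝ≥0} {q : S → S → ℝ≥0} (hπ : Measurable π) (hπ_one : ∫⁻ x, π x ∂μ = 1)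
    (hπhat : Measurable πhat) (hπhat_pos : ∀ x, 0 < π x → 0 < πhat x)
    (hq : Measurable (Function.uncurry q)) (hq_one : ∀ x, ∫⁻ y, q x y ∂μ = 1)
    (hcond : ∀ ε : ℝ, 0 < ε → ∃ m : ℝ, ∀ᵐ x ∂(target μ π),
      ∫⁻ y in potentialProblemSet π πhat q m x \ noProblemSet π πhat q x, q x y ∂μ ≤
        ENNReal.ofReal ε)
    (hMH : VarianceBounding (kernelMH μ π q) (target μ π)) :
    VarianceBounding (kernelDA μ π πhat q) (target μ π) := by
  refine VarianceBounding.of_flux_le hπ hπ_one hq hq_one (measurable_alphaMH hπ hq)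
    (fun _ _ => min_le_left _ _) flux_alphaMH_symm (measurable_alphaDA hπ hπhat hq)
    (fun _ _ => mul_le_one' (min_le_left _ _) (min_le_left _ _))
    (flux_alphaDA_symm hπhat_pos) (fun ε hε => ?_) hMH
  obtain ⟨m, hm⟩ := hcond ε hε
  refine ⟨(Real.exp |m|).toNNReal, hm.mono fun x hx => (lintegral_mono_set fun y hy => ?_).trans hx⟩
  by_contra hyM
  exact hy.not_ge (flux_alphaMH_le_exp_mul hπhat_pos fun hM => of_not_not fun hC => hyM ⟨hM, hC⟩)

theorem corollary1 {d : ℕ} (X : Set (LebesgueSpace d)) (hX : MeasurableSet X)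
    (π πhat : X → ℝ≥0) (q : X → X → ℝ≥0)
    (hπ : Measurable π)
    (hπ_one : ∫⁻ x, π x ∂(lebesgueOn X) = 1)
    (hπhat : Measurable πhat)
    (hπhat_pos : ∀ x, 0 < π x → 0 < πhat x)
    (hq : Measurable (Function.uncurry q))
    (hq_one : ∀ x, ∫⁻ y, q x y ∂(lebesgueOn X) = 1)
    (hcond : ∀ ε : ℝ, 0 < ε → ∃ m : ℝ,
      ∀ᵐ x ∂(target (lebesgueOn X) π),
        ∃ D : Set X, MeasurableSet D ∧
          potentialProblemSet π πhat q m x ∩ D ⊆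
            noProblemSet π πhat q x ∧
          ∫⁻ y in Dᶜ, q x y ∂(lebesgueOn X) ≤ ENNReal.ofReal ε)
    (hMH : VarianceBounding
      (kernelMH (lebesgueOn X) π q)
      (target (lebesgueOn X) π)) :
    VarianceBounding
      (kernelDA (lebesgueOn X) π πhat q)
      (target (lebesgueOn X) π) := by
  refine corollary1_general hπ hπ_one hπhat hπhat_pos hq hq_one (fun ε hε => ?_) hMH
  exact (hcond ε hε).imp fun _ hm => hm.mono fun _ ⟨_, _, hsub, hD⟩ =>
    (lintegral_mono_set fun _ hy hyD => hy.2 (hsub ⟨hy.1, hyD⟩)).trans hD
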